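/- Let $C$ be a commutative $\mathbb{C}$-algebra and let $B$ be an Azumaya algebra over $C$. For $b\in B$ and $t\in C$ say that $b$ has (reduced) trace $t$, written $\mathrm{tr}(b)=t$, if there are an étale cover $\{C\to D_j\}_{j=1}^r$ (each $C\to D_j$ is étale and $\prod_j D_j$ is faithfully flat over $C$), positive integers $n_j$ and isomorphisms of $D_j$-algebras $\varphi_j\colon D_j\otimes_C B\to M_{n_j}(D_j)$ such that the matrix trace of $\varphi_j(1\otimes b)$ is the image of $t$ in $D_j$ for every $j$. Let $\alpha=(d_1,\dots,d_k)$ be a tuple of natural numbers, and suppose that $B$ is of dimension vector $\alpha$, i.e. $B$ is equipped with idempotents $e_1,\dots,e_k\in B$ such that $e_ie_j=0$ for $i\neq j$, $\sum_i e_i=1$ and $\mathrm{tr}(e_i)=d_i$ for all $i$. Let $\mathrm{Br}(C)$ be the Brauer group of $C$: its elements are the classes of Azumaya algebras over $C$, where $A\sim A'$ if $A\otimes_C\mathrm{End}_C(P)\cong A'\otimes_C\mathrm{End}_C(Q)$ as $C$-algebras for some finitely generated projective faithful $C$-modules $P,Q$, and the product is induced by $\otimes_C$. The period of $B$ is the order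 of $[B]$ in $\mathrm{Br}(C)$. Then the period of $B$ divides $\gcd(d_1,\dots,d_k)$. In particular, if $\gcd(d_1,\dots,d_k)=1$, then $[B]=1$ in $\mathrm{Br}(C)$. (If all $d_i$ are zero, in particular if $k=0$, the gcd is $0$ and the divisibility is vacuous; otherwise it includes that the period is finite.) -/

import Mathlib

open scoped TensorProduct

universe u

namespace Azumaya

/-! ### Closure properties of Azumaya algebras -/

section Closure

variable {C : Type u} [CommRing C]

theorem eq_zero_of_forall_dual {P : Type u} [AddCommGroup P] [Module C P] [Module.Projective C P]
    (p : P) (h : ∀ f : Module.Dual C P, f p = 0) : p = 0 := by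
  obtain ⟨s, hs⟩ := Module.Projective.out (R := C) (P := P)
  have h0 : s p = 0 := by
    ext q
    exact h ((Finsupp.lapply (R := C) q).comp s)
  rw [← hs p, h0, map_zero]

theorem faithfulSMul_tensor {P Q : Type u} [AddCommGroup P] [Module C P] [Module.Projective C P]
    [FaithfulSMul C P] [AddCommGroup Q] [Module C Q] [FaithfulSMul C Q] :
    FaithfulSMul C (P ⊗[C] Q) := by
  refine ⟨fun {x y} hxy => ?_⟩
  rw [← sub_eq_zero]
  have key : ∀ p : P, (x - y) • p = 0 := by
    intro p
    refine eq_zero_of_forall_dual (C := C) _ fun f => ?_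
    refine FaithfulSMul.eq_of_smul_eq_smul (α := Q) fun q => ?_
    have h1 := congrArg (TensorProduct.lid C Q ∘ LinearMap.rTensor Q f) (hxy (p ⊗ₜ[C] q))
    simp only [Function.comp_apply, map_smul, LinearMap.rTensor_tmul, TensorProduct.lid_tmul] at h1
    rw [map_smul, zero_smul, smul_eq_mul, mul_smul, sub_smul, h1, sub_self]
  exact FaithfulSMul.eq_of_smul_eq_smul (α := P) fun p => by rw [key p, zero_smul]

theorem exists_retract (P : Type u) [AddCommGroup P] [Module C P] [Module.Projective C P]
    [Module.Finite C P] : ∃ (n : ℕ) (s : P →ₗ[C] (Fin n → C)) (r : (Fin n → C) →ₗ[C] P),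
      r ∘ₗ s = LinearMap.id := by
  obtain ⟨n, r, s, -, -, h⟩ := Module.Finite.exists_comp_eq_id_of_projective C P
  exact ⟨n, s, r, h⟩

/-- The map `f ↦ s ∘ f ∘ r` on endomorphisms. -/
def sandwich {P F : Type u} [AddCommGroup P] [Module C P] [AddCommGroup F] [Module C F]
    (s : P →ₗ[C] F) (r : F →ₗ[C] P) : Module.End C P →ₗ[C] Module.End C F where
  toFun f := s ∘ₗ f ∘ₗ r
  map_add' f g := by ext; simp
  map_smul' c f := by ext; simp

theorem sandwich_apply {P F : Type u} [AddCommGroup P] [Module C P] [AddCommGroup F] [Module C F]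
    (s : P →ₗ[C] F) (r : F →ₗ[C] P) (f : Module.End C P) (x : F) :
    sandwich s r f x = s (f (r x)) := rfl

theorem endTensorEnd_tmul {P Q : Type u} [AddCommGroup P] [Module C P] [AddCommGroup Q]
    [Module C Q] (f : Module.End C P) (g : Module.End C Q) (p : P) (q : Q) :
    (Module.endTensorEndAlgHom :
      Module.End C P ⊗[C] Module.End C Q →ₐ[C] Module.End C (P ⊗[C] Q)) (f ⊗ₜ g) (p ⊗ₜ q) =
      f p ⊗ₜ g q := rfl

/-- `End P ⊗ End Q → End (P ⊗ Q)` is bijective for finitely generated projective modules. -/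
theorem bijective_endTensorEnd (P Q : Type u) [AddCommGroup P] [Module C P] [Module.Projective C P]
    [Module.Finite C P] [AddCommGroup Q] [Module C Q] [Module.Projective C Q] [Module.Finite C Q] :
    Function.Bijective (Module.endTensorEndAlgHom :
      Module.End C P ⊗[C] Module.End C Q →ₐ[C] Module.End C (P ⊗[C] Q)) := by
  obtain ⟨n, s, r, hrs⟩ := exists_retract (C := C) P
  obtain ⟨m, t, v, hvt⟩ := exists_retract (C := C) Q
  let F := Fin n → C
  let G := Fin m → C
  let up1 : Module.End C P →ₗ[C] Module.End C F := sandwich s r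
  let up2 : Module.End C Q →ₗ[C] Module.End C G := sandwich t v
  let dn1 : Module.End C F →ₗ[C] Module.End C P := sandwich r s
  let dn2 : Module.End C G →ₗ[C] Module.End C Q := sandwich v t
  have hr : ∀ p, r (s p) = p := fun p => LinearMap.congr_fun hrs p
  have hv : ∀ q, v (t q) = q := fun q => LinearMap.congr_fun hvt q
  have hd1 : dn1 ∘ₗ up1 = LinearMap.id := by
    ext f p; simp [dn1, up1, hr, sandwich_apply]
  have hd2 : dn2 ∘ₗ up2 = LinearMap.id := by
    ext f p; simp [dn2, up2, hv, sandwich_apply]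
  have hup : ∀ x : Module.End C P ⊗[C] Module.End C Q,
      homTensorHomEquiv C F G F G (TensorProduct.map up1 up2 x) =
        TensorProduct.map s t ∘ₗ (Module.endTensorEndAlgHom (S := C) (A := C) x) ∘ₗ
          TensorProduct.map r v := by
    intro x
    induction x with
    | zero => simp
    | add x y hx hy => simp only [map_add, hx, hy, LinearMap.add_comp, LinearMap.comp_add]
    | tmul f g =>
      rw [homTensorHomEquiv_apply]
      ext i j
      simp [up1, up2, sandwich_apply, endTensorEnd_tmul]
  have hdn : ∀ y : Module.End C F ⊗[C] Module.End C G,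
      Module.endTensorEndAlgHom (S := C) (A := C) (TensorProduct.map dn1 dn2 y) =
        TensorProduct.map r v ∘ₗ homTensorHomEquiv C F G F G y ∘ₗ TensorProduct.map s t := by
    intro x
    induction x with
    | zero => simp
    | add x y hx hy => simp only [map_add, hx, hy, LinearMap.add_comp, LinearMap.comp_add]
    | tmul f g =>
      rw [homTensorHomEquiv_apply]
      ext i j
      simp [dn1, dn2, sandwich_apply, endTensorEnd_tmul]
  constructor
  · rw [injective_iff_map_eq_zero]
    intro x hx
    have h1 := hup x
    rw [hx] at h1
    have h2 : TensorProduct.map up1 up2 x = 0 := by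
      apply (homTensorHomEquiv C F G F G).injective
      rw [h1]; ext; simp
    have h3 := congrArg (TensorProduct.map dn1 dn2) h2
    rw [← LinearMap.comp_apply, ← TensorProduct.map_comp, hd1, hd2, TensorProduct.map_id,
      map_zero] at h3
    exact h3
  · intro f
    refine ⟨TensorProduct.map dn1 dn2 ((homTensorHomEquiv C F G F G).symm
      (TensorProduct.map s t ∘ₗ f ∘ₗ TensorProduct.map r v)), ?_⟩
    rw [hdn, LinearEquiv.apply_symm_apply]
    have h1 : TensorProduct.map r v ∘ₗ TensorProduct.map s t = LinearMap.id := by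
      rw [← TensorProduct.map_comp, hrs, hvt, TensorProduct.map_id]
    have h2 : ∀ z, TensorProduct.map r v (TensorProduct.map s t z) = z :=
      fun z => LinearMap.congr_fun h1 z
    refine LinearMap.ext fun z => ?_
    simp only [LinearMap.comp_apply, h2]

/-- `End P ⊗ End Q ≃ End (P ⊗ Q)` for finitely generated projective modules. -/
noncomputable def endTensorEquiv (P Q : Type u) [AddCommGroup P] [Module C P]
    [Module.Projective C P] [Module.Finite C P] [AddCommGroup Q] [Module C Q]
    [Module.Projective C Q] [Module.Finite C Q] :
    Module.End C P ⊗[C] Module.End C Q ≃ₐ[C] Module.End C (P ⊗[C] Q) :=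
  AlgEquiv.ofBijective _ (bijective_endTensorEnd P Q)

theorem isAzumaya_tensor (A B : Type u) [Ring A] [Algebra C A] [Ring B] [Algebra C B]
    [IsAzumaya C A] [IsAzumaya C B] : IsAzumaya C (A ⊗[C] B) :=
  { toProjective := inferInstance
    toFaithfulSMul := faithfulSMul_tensor
    toFinite := inferInstance
    bij := by
      let E : (A ⊗[C] Aᵐᵒᵖ) ⊗[C] (B ⊗[C] Bᵐᵒᵖ) ≃ₐ[C] (A ⊗[C] B) ⊗[C] (A ⊗[C] B)ᵐᵒᵖ :=
        (Algebra.TensorProduct.tensorTensorTensorComm C C C C A Aᵐᵒᵖ B Bᵐᵒᵖ).trans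
          (Algebra.TensorProduct.congr AlgEquiv.refl (Algebra.TensorProduct.opAlgEquiv C C A B))
      let G : (A ⊗[C] Aᵐᵒᵖ) ⊗[C] (B ⊗[C] Bᵐᵒᵖ) ≃ₐ[C] Module.End C (A ⊗[C] B) :=
        (Algebra.TensorProduct.congr
          (AlgEquiv.ofBijective (AlgHom.mulLeftRight C A) IsAzumaya.bij)
          (AlgEquiv.ofBijective (AlgHom.mulLeftRight C B) IsAzumaya.bij)).trans
          (endTensorEquiv A B)
      have h : (AlgHom.mulLeftRight C (A ⊗[C] B)).comp E.toAlgHom = G.toAlgHom := by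
        have hE : ∀ (a : A) (a' : Aᵐᵒᵖ) (b : B) (b' : Bᵐᵒᵖ), E ((a ⊗ₜ a') ⊗ₜ (b ⊗ₜ b')) =
            (a ⊗ₜ b) ⊗ₜ MulOpposite.op (a'.unop ⊗ₜ b'.unop) := fun _ _ _ _ => rfl
        have hG : ∀ (a : A) (a' : Aᵐᵒᵖ) (b : B) (b' : Bᵐᵒᵖ) (x : A) (y : B),
            G ((a ⊗ₜ a') ⊗ₜ (b ⊗ₜ b')) (x ⊗ₜ y) =
              AlgHom.mulLeftRight C A (a ⊗ₜ a') x ⊗ₜ AlgHom.mulLeftRight C B (b ⊗ₜ b') y :=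
          fun _ _ _ _ _ _ => rfl
        refine AlgHom.toLinearMap_injective ?_
        ext a a' b b' x y
        simp only [TensorProduct.AlgebraTensorModule.curry_apply, TensorProduct.curry_apply,
          LinearMap.coe_restrictScalars, AlgHom.toLinearMap_apply, AlgHom.comp_apply]
        change AlgHom.mulLeftRight C (A ⊗[C] B) (E ((a ⊗ₜ a') ⊗ₜ (b ⊗ₜ b'))) (x ⊗ₜ y) =
          G ((a ⊗ₜ a') ⊗ₜ (b ⊗ₜ b')) (x ⊗ₜ y)
        rw [hE, hG]
        simp
      have h2 : Function.Bijective ((AlgHom.mulLeftRight C (A ⊗[C] B)) ∘ E) := by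
        have h3 : (AlgHom.mulLeftRight C (A ⊗[C] B)) ∘ E = G :=
          funext fun x => DFunLike.congr_fun h x
        rw [h3]; exact G.bijective
      exact (Function.Bijective.of_comp_iff _ E.bijective).1 h2 }

theorem isAzumaya_op (A : Type u) [Ring A] [Algebra C A] [IsAzumaya C A] : IsAzumaya C Aᵐᵒᵖ :=
  { toProjective := Module.Projective.of_equiv (MulOpposite.opLinearEquiv C : A ≃ₗ[C] Aᵐᵒᵖ)
    toFaithfulSMul := ⟨fun {x y} h => FaithfulSMul.eq_of_smul_eq_smul (α := A) fun a =>
      MulOpposite.op_injective (h (MulOpposite.op a))⟩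
    toFinite := Module.Finite.equiv (MulOpposite.opLinearEquiv C : A ≃ₗ[C] Aᵐᵒᵖ)
    bij := by
      let E : A ⊗[C] Aᵐᵒᵖ ≃ₐ[C] Aᵐᵒᵖ ⊗[C] Aᵐᵒᵖᵐᵒᵖ :=
        (Algebra.TensorProduct.comm C A Aᵐᵒᵖ).trans
          (Algebra.TensorProduct.congr AlgEquiv.refl (AlgEquiv.opOp C A))
      let G : A ⊗[C] Aᵐᵒᵖ ≃ₐ[C] Module.End C Aᵐᵒᵖ :=
        (AlgEquiv.ofBijective (AlgHom.mulLeftRight C A) IsAzumaya.bij).trans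
          ((MulOpposite.opLinearEquiv C : A ≃ₗ[C] Aᵐᵒᵖ).conjAlgEquiv C)
      have h : (AlgHom.mulLeftRight C Aᵐᵒᵖ).comp E.toAlgHom = G.toAlgHom := by
        ext <;> simp [E, G]
      have h2 : Function.Bijective ((AlgHom.mulLeftRight C Aᵐᵒᵖ) ∘ E) := by
        have h3 : (AlgHom.mulLeftRight C Aᵐᵒᵖ) ∘ E = G :=
          funext fun x => DFunLike.congr_fun h x
        rw [h3]; exact G.bijective
      exact (Function.Bijective.of_comp_iff _ E.bijective).1 h2 }

end Closure

/-! ### The Brauer group of a commutative ring -/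

/-- The Azumaya algebras over a commutative ring `C`. -/
structure Alg (C : Type u) [CommRing C] where
  /-- The underlying type. -/
  carrier : Type u
  [ring : Ring carrier]
  [algebra : Algebra C carrier]
  [isAzumaya : IsAzumaya C carrier]

attribute [instance] Alg.ring Alg.algebra Alg.isAzumaya

/-- Brauer equivalence of `C`-algebras: `A ⊗ End P ≃ B ⊗ End Q` for some finitely generated,
projective, faithful `C`-modules `P` and `Q`. -/
def BrauerEquivalent (C A B : Type u) [CommRing C] [Ring A] [Algebra C A] [Ring B] [Algebra C B] :
    Prop :=
  ∃ (P Q : Type u) (_ : AddCommGroup P) (_ : Module C P) (_ : AddCommGroup Q) (_ : Module C Q),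
    (Module.Finite C P ∧ Module.Projective C P ∧ FaithfulSMul C P) ∧
    (Module.Finite C Q ∧ Module.Projective C Q ∧ FaithfulSMul C Q) ∧
    Nonempty (A ⊗[C] Module.End C P ≃ₐ[C] B ⊗[C] Module.End C Q)

namespace BrauerEquivalent

variable {C A B D A' B' : Type u} [CommRing C] [Ring A] [Algebra C A] [Ring B] [Algebra C B]
  [Ring D] [Algebra C D] [Ring A'] [Algebra C A'] [Ring B'] [Algebra C B']

theorem of_algEquiv (e : A ≃ₐ[C] B) : BrauerEquivalent C A B :=
  ⟨C, C, inferInstance, inferInstance, inferInstance, inferInstance,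
    ⟨inferInstance, inferInstance, inferInstance⟩, ⟨inferInstance, inferInstance, inferInstance⟩,
    ⟨Algebra.TensorProduct.congr e AlgEquiv.refl⟩⟩

theorem symm (h : BrauerEquivalent C A B) : BrauerEquivalent C B A := by
  obtain ⟨P, Q, _, _, _, _, hP, hQ, ⟨e⟩⟩ := h
  exact ⟨Q, P, inferInstance, inferInstance, inferInstance, inferInstance, hQ, hP, ⟨e.symm⟩⟩

theorem trans (h : BrauerEquivalent C A B) (h' : BrauerEquivalent C B D) :
    BrauerEquivalent C A D := by
  obtain ⟨P, Q, _, _, _, _, ⟨_, _, _⟩, ⟨_, _, _⟩, ⟨e⟩⟩ := h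
  obtain ⟨R, S, _, _, _, _, ⟨_, _, _⟩, ⟨_, _, _⟩, ⟨f⟩⟩ := h'
  refine ⟨P ⊗[C] R, S ⊗[C] Q, inferInstance, inferInstance, inferInstance, inferInstance,
    ⟨inferInstance, inferInstance, faithfulSMul_tensor⟩,
    ⟨inferInstance, inferInstance, faithfulSMul_tensor⟩, ⟨?_⟩⟩
  have e1 : A ⊗[C] Module.End C (P ⊗[C] R) ≃ₐ[C] (A ⊗[C] Module.End C P) ⊗[C] Module.End C R :=
    (Algebra.TensorProduct.congr AlgEquiv.refl (endTensorEquiv P R).symm).trans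
      (Algebra.TensorProduct.assoc C C C A (Module.End C P) (Module.End C R)).symm
  have e2 : (B ⊗[C] Module.End C Q) ⊗[C] Module.End C R ≃ₐ[C]
      (B ⊗[C] Module.End C R) ⊗[C] Module.End C Q :=
    ((Algebra.TensorProduct.assoc C C C B (Module.End C Q) (Module.End C R)).trans
      (Algebra.TensorProduct.congr AlgEquiv.refl (Algebra.TensorProduct.comm C _ _))).trans
      (Algebra.TensorProduct.assoc C C C B (Module.End C R) (Module.End C Q)).symm
  have e3 : (D ⊗[C] Module.End C S) ⊗[C] Module.End C Q ≃ₐ[C] D ⊗[C] Module.End C (S ⊗[C] Q) :=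
    (Algebra.TensorProduct.assoc C C C D (Module.End C S) (Module.End C Q)).trans
      (Algebra.TensorProduct.congr AlgEquiv.refl (endTensorEquiv S Q))
  exact ((((e1.trans (Algebra.TensorProduct.congr e AlgEquiv.refl)).trans e2).trans
    (Algebra.TensorProduct.congr f AlgEquiv.refl)).trans e3)

theorem tensor (h : BrauerEquivalent C A A') (h' : BrauerEquivalent C B B') :
    BrauerEquivalent C (A ⊗[C] B) (A' ⊗[C] B') := by
  obtain ⟨P, Q, _, _, _, _, ⟨_, _, _⟩, ⟨_, _, _⟩, ⟨e⟩⟩ := h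
  obtain ⟨R, S, _, _, _, _, ⟨_, _, _⟩, ⟨_, _, _⟩, ⟨f⟩⟩ := h'
  refine ⟨P ⊗[C] R, Q ⊗[C] S, inferInstance, inferInstance, inferInstance, inferInstance,
    ⟨inferInstance, inferInstance, faithfulSMul_tensor⟩,
    ⟨inferInstance, inferInstance, faithfulSMul_tensor⟩, ⟨?_⟩⟩
  have e1 : (A ⊗[C] B) ⊗[C] Module.End C (P ⊗[C] R) ≃ₐ[C]
      (A ⊗[C] Module.End C P) ⊗[C] (B ⊗[C] Module.End C R) :=
    (Algebra.TensorProduct.congr AlgEquiv.refl (endTensorEquiv P R).symm).trans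
      (Algebra.TensorProduct.tensorTensorTensorComm C C C C A B _ _)
  have e2 : (A' ⊗[C] Module.End C Q) ⊗[C] (B' ⊗[C] Module.End C S) ≃ₐ[C]
      (A' ⊗[C] B') ⊗[C] Module.End C (Q ⊗[C] S) :=
    (Algebra.TensorProduct.tensorTensorTensorComm C C C C A' _ B' _).trans
      (Algebra.TensorProduct.congr AlgEquiv.refl (endTensorEquiv Q S))
  exact (e1.trans (Algebra.TensorProduct.congr e f)).trans e2

theorem op_left [IsAzumaya C A] : BrauerEquivalent C (Aᵐᵒᵖ ⊗[C] A) C :=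
  ⟨C, A, inferInstance, inferInstance, inferInstance, inferInstance,
    ⟨inferInstance, inferInstance, inferInstance⟩, ⟨inferInstance, inferInstance, inferInstance⟩,
    ⟨((Algebra.TensorProduct.congr AlgEquiv.refl
        ((AlgEquiv.moduleEndSelf C).symm.trans (AlgEquiv.toOpposite C C).symm)).trans (Algebra.TensorProduct.rid C C _)).trans
      (((Algebra.TensorProduct.comm C Aᵐᵒᵖ A).trans
        (AlgEquiv.ofBijective (AlgHom.mulLeftRight C A) IsAzumaya.bij)).trans
        (Algebra.TensorProduct.lid C _).symm)⟩⟩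

theorem op [IsAzumaya C A] [IsAzumaya C B] (h : BrauerEquivalent C A B) :
    BrauerEquivalent C Aᵐᵒᵖ Bᵐᵒᵖ := by
  have h1 : BrauerEquivalent C Aᵐᵒᵖ (Aᵐᵒᵖ ⊗[C] (Bᵐᵒᵖ ⊗[C] B)) :=
    (of_algEquiv (Algebra.TensorProduct.rid C C Aᵐᵒᵖ).symm).trans
      (tensor (of_algEquiv AlgEquiv.refl) op_left.symm)
  have h2 : BrauerEquivalent C (Aᵐᵒᵖ ⊗[C] (Bᵐᵒᵖ ⊗[C] B)) (Aᵐᵒᵖ ⊗[C] (Bᵐᵒᵖ ⊗[C] A)) :=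
    tensor (of_algEquiv AlgEquiv.refl) (tensor (of_algEquiv AlgEquiv.refl) h.symm)
  have h3 : BrauerEquivalent C (Aᵐᵒᵖ ⊗[C] (Bᵐᵒᵖ ⊗[C] A)) ((Aᵐᵒᵖ ⊗[C] A) ⊗[C] Bᵐᵒᵖ) :=
    of_algEquiv ((Algebra.TensorProduct.congr AlgEquiv.refl
      (Algebra.TensorProduct.comm C Bᵐᵒᵖ A)).trans
        (Algebra.TensorProduct.assoc C C C Aᵐᵒᵖ A Bᵐᵒᵖ).symm)
  have h4 : BrauerEquivalent C ((Aᵐᵒᵖ ⊗[C] A) ⊗[C] Bᵐᵒᵖ) Bᵐᵒᵖ :=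
    (tensor (op_left (C := C) (A := A)) (of_algEquiv AlgEquiv.refl)).trans
      (of_algEquiv (Algebra.TensorProduct.lid C Bᵐᵒᵖ))
  exact ((h1.trans h2).trans h3).trans h4

end BrauerEquivalent

/-- Brauer equivalence as an equivalence relation on the Azumaya algebras over `C`. -/
instance brauerSetoid (C : Type u) [CommRing C] : Setoid (Alg C) where
  r A B := BrauerEquivalent C A.carrier B.carrier
  iseqv :=
    { refl := fun _ => BrauerEquivalent.of_algEquiv AlgEquiv.refl
      symm := BrauerEquivalent.symm
      trans := BrauerEquivalent.trans }

/-- The Brauer group `Br(C)` of a commutative ring `C`: Azumaya algebras over `C` up to Brauer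
equivalence. -/
def Br (C : Type u) [CommRing C] : Type (u + 1) := Quotient (brauerSetoid C)

/-- The class in `Br(C)` of an Azumaya algebra. -/
def brauerClass (C A : Type u) [CommRing C] [Ring A] [Algebra C A] [IsAzumaya C A] : Br C :=
  Quotient.mk (brauerSetoid C) ⟨A⟩

/-- The group law on `Br(C)` is the tensor product over `C`; the unit is the class of `C`, and the
inverse is the opposite algebra. -/
noncomputable instance (C : Type u) [CommRing C] : CommGroup (Br C) where
  mul := Quotient.map₂
    (fun A B => have := isAzumaya_tensor (C := C) A.carrier B.carrier
      ⟨A.carrier ⊗[C] B.carrier⟩)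
    (fun _ _ h _ _ h' => BrauerEquivalent.tensor h h')
  one := brauerClass C C
  inv := Quotient.map
    (fun A => have := isAzumaya_op (C := C) A.carrier
      ⟨A.carrierᵐᵒᵖ⟩)
    (fun _ _ h => BrauerEquivalent.op h)
  mul_assoc := by
    rintro ⟨A⟩ ⟨B⟩ ⟨D⟩
    exact Quotient.sound (s := brauerSetoid C)
      (BrauerEquivalent.of_algEquiv (Algebra.TensorProduct.assoc C C C _ _ _))
  one_mul := by
    rintro ⟨A⟩
    exact Quotient.sound (s := brauerSetoid C)
      (BrauerEquivalent.of_algEquiv (Algebra.TensorProduct.lid C _))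
  mul_one := by
    rintro ⟨A⟩
    exact Quotient.sound (s := brauerSetoid C)
      (BrauerEquivalent.of_algEquiv (Algebra.TensorProduct.rid C C _))
  mul_comm := by
    rintro ⟨A⟩ ⟨B⟩
    exact Quotient.sound (s := brauerSetoid C)
      (BrauerEquivalent.of_algEquiv (Algebra.TensorProduct.comm C _ _))
  inv_mul_cancel := by
    rintro ⟨A⟩
    exact Quotient.sound (s := brauerSetoid C) BrauerEquivalent.op_left

/-- The period of an Azumaya algebra: the order of its class in the Brauer group (`0` if the order
is infinite). -/
noncomputable def period (C A : Type u) [CommRing C] [Ring A] [Algebra C A] [IsAzumaya C A] : ℕ :=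
  orderOf (brauerClass C A)

/-! ### Reduced traces and dimension vectors -/

/-- An étale splitting of a `C`-algebra `B`: an étale cover `C → D₁, …, C → Dᵣ`
together with isomorphisms of `Dᵢ ⊗ B` with matrix algebras over `Dᵢ`. -/
structure EtaleSplitting (C B : Type u) [CommRing C] [Ring B] [Algebra C B] where
  /-- The number of members of the cover. -/
  r : ℕ
  /-- The members of the cover. -/
  D : Fin r → Type u
  [commRing : ∀ i, CommRing (D i)]
  [algebra : ∀ i, Algebra C (D i)]
  etale : ∀ i, Algebra.Etale C (D i)
  faithfullyFlat : Module.FaithfullyFlat C (∀ i, D i)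
  /-- The sizes of the matrices. -/
  n : Fin r → ℕ
  n_pos : ∀ i, 0 < n i
  /-- The splitting isomorphisms. -/
  iso : ∀ i, D i ⊗[C] B ≃ₐ[D i] Matrix (Fin (n i)) (Fin (n i)) (D i)

attribute [instance] EtaleSplitting.commRing EtaleSplitting.algebra

/-- `t : C` is the (reduced) trace of the element `b` of the Azumaya algebra `B`: on an étale
splitting of `B`, the image of `b` has matrix trace `t`. (The reduced trace does not depend on the
splitting.) -/
def IsReducedTrace {C B : Type u} [CommRing C] [Ring B] [Algebra C B] (b : B) (t : C) : Prop :=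
  ∃ S : EtaleSplitting C B, ∀ i, (S.iso i (1 ⊗ₜ[C] b)).trace = algebraMap C (S.D i) t

/-- The family `e₁, …, e_k` makes the `C`-algebra `B` into an algebra of dimension vector
`(d₁, …, d_k)`: it is a complete set of orthogonal idempotents, and `eᵢ` has trace `dᵢ`. -/
structure HasDimensionVector (C : Type u) {B : Type u} [CommRing C] [Ring B] [Algebra C B] {k : ℕ}
    (d : Fin k → ℕ) (e : Fin k → B) : Prop where
  idempotents : CompleteOrthogonalIdempotents e
  trace : ∀ i, IsReducedTrace (e i) (d i : C)

end Azumaya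

/-!
Let `e` be an idempotent of reduced trace `d`. Over a splitting, `e` is an idempotent matrix of rank
`d`, and the antisymmetrisation of `e ⊗ ⋯ ⊗ e` (`d` factors) is the matrix of its minors of size
`d`. This matrix has rank one because the `d`-th exterior power of the image of `e` is a line, and
its trace is `d!`. The permutations of the tensor factors come from elements of `B^{⊗d}`: the
transposition of two factors is the Goldman element `∑ a ⊗ b`, characterised by
`∑ a x b = tr x`. Here the trace of every `x : B` lies in `C` because `B = C e + [B, B]`, the trace
`d` of `e` being a unit. So the antisymmetrisation is an element of `B^{⊗d}`. Dividing it by `d!`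
gives an idempotent `ε` of rank one, so that `B^{⊗d}` is the endomorphism algebra of `B^{⊗d} ε` and
`[B]^d = 1`.
-/

namespace Azumaya

open Matrix

/-! ### Minors of idempotent matrices -/

section Minors

variable {R p q κ : Type*} [CommRing R] [Fintype κ] [DecidableEq κ]

variable (κ) in
/-- The matrix of all minors of `M` of size `κ`, indexed by not necessarily injective families of
rows and of columns. If `M` acts on `V`, this is the action of the antisymmetrisation of
`M ⊗ ⋯ ⊗ M` on the tensor power of `V` indexed by `κ`. -/
def minorMatrix (M : Matrix p q R) : Matrix (κ → p) (κ → q) R :=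
  of fun f h => (M.submatrix f h).det

theorem minorMatrix_apply (M : Matrix p q R) (f : κ → p) (h : κ → q) :
    minorMatrix κ M f h = (M.submatrix f h).det :=
  rfl

theorem minorMatrix_map {S : Type*} [CommRing S] (g : R →+* S) (M : Matrix p q R) :
    (minorMatrix κ M).map g = minorMatrix κ (M.map g) := by
  ext f h
  rw [map_apply, minorMatrix_apply, minorMatrix_apply, RingHom.map_det]
  rfl

theorem minorMatrix_mul (U : Matrix p κ R) (V : Matrix κ q R) :
    minorMatrix κ (U * V) =
      vecMulVec (fun f => (U.submatrix f id).det) fun h => (V.submatrix id h).det := by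
  ext f h
  rw [minorMatrix_apply, vecMulVec_apply, ← det_mul,
    submatrix_mul _ _ f id h Function.bijective_id]

theorem sum_prod_mul_det_submatrix [Fintype p] (V : Matrix κ p R) (W : Matrix p κ R) :
    ∑ f : κ → p, (∏ k, W (f k) k) * (V.submatrix id f).det = (V * W).det := by
  simp only [det_apply', mul_apply, Finset.prod_univ_sum, Fintype.piFinset_univ, Finset.mul_sum]
  rw [Finset.sum_comm]
  refine Finset.sum_congr rfl fun σ _ => Finset.sum_congr rfl fun f _ => ?_
  rw [Finset.prod_mul_distrib]
  simp only [submatrix_apply, id]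
  ring

/-- The Cauchy–Binet formula; a set of columns is counted once for each of its orderings. -/
theorem sum_det_submatrix_mul_det_submatrix [Fintype p] (U : Matrix p κ R) (V : Matrix κ p R) :
    ∑ f : κ → p, (U.submatrix f id).det * (V.submatrix id f).det =
      (Fintype.card κ).factorial * (V * U).det := by
  have sum_term (σ : Equiv.Perm κ) :
      ∑ f : κ → p, Equiv.Perm.sign σ * (∏ k, U (f k) (σ k)) * (V.submatrix id f).det =
        (V * U).det := by
    have h : _ = ((V * U).submatrix id σ).det :=
      sum_prod_mul_det_submatrix V (U.submatrix id σ)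
    simp only [mul_assoc, ← Finset.mul_sum]
    rw [← one_mul (V * U).det, ← Int.cast_one, ← Int.units_coe_mul_self (Equiv.Perm.sign σ),
      Int.cast_mul, mul_assoc, ← det_permute', ← h]
    rfl
  have expand (f : κ → p) : (U.submatrix f id).det =
      ∑ σ : Equiv.Perm κ, Equiv.Perm.sign σ * ∏ k, U (f k) (σ k) := by
    rw [← det_transpose, det_apply']
    rfl
  simp only [expand, Finset.sum_mul]
  rw [Finset.sum_comm, Finset.sum_congr rfl fun σ _ => sum_term σ, Finset.sum_const,
    Finset.card_univ, Fintype.card_perm, nsmul_eq_mul]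

theorem trace_minorMatrix_mul [Fintype p] (U : Matrix p κ R) (V : Matrix κ p R) :
    (minorMatrix κ (U * V)).trace = (Fintype.card κ).factorial * (V * U).det := by
  rw [minorMatrix_mul, trace_vecMulVec, dotProduct, sum_det_submatrix_mul_det_submatrix]

theorem vecMulVec_mul_mul_vecMulVec {n : Type*} [Fintype n] (v w : n → R) (X : Matrix n n R) :
    vecMulVec v w * X * vecMulVec v w = (vecMulVec v w * X).trace • vecMulVec v w := by
  rw [vecMulVec_mul, vecMulVec_mul_vecMulVec, trace_vecMulVec, dotProduct_comm, vecMulVec_smul]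

section Idempotent

variable {n : Type*} [Fintype n]

theorem exists_mul_eq_and_mul_eq_one_of_isLocalRing [IsLocalRing R] [CharZero R]
    {e : Matrix n n R} (he : IsIdempotentElem e) {d : ℕ} (hd : e.trace = d) :
    ∃ (U : Matrix n (Fin d) R) (V : Matrix (Fin d) n R), U * V = e ∧ V * U = 1 := by
  classical
  let φ := toLin' e
  have hφ : IsIdempotentElem φ := he.map (toLinAlgEquiv' (R := R) (n := n))
  have hrange := LinearMap.IsIdempotentElem.isProj_range _ hφ
  have hker := LinearMap.IsIdempotentElem.isProj_range _ hφ.one_sub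
  rw [show (1 - φ).range = φ.ker from
    (LinearMap.IsIdempotentElem.ker_eq_range hφ).symm] at hker
  have : Module.Projective R φ.range :=
    .of_split (Submodule.subtype _) hrange.codRestrict (by ext x; simp)
  have : Module.Projective R φ.ker :=
    .of_split (Submodule.subtype _) hker.codRestrict (by ext x; simp)
  have : Module.Finite R φ.ker := .of_surjective hker.codRestrict fun x => ⟨x, by simp⟩
  have := Module.free_of_flat_of_isLocalRing (R := R) (P := φ.range)
  have := Module.free_of_flat_of_isLocalRing (R := R) (P := φ.ker)
  have hrank : d = Module.finrank R φ.range := by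
    have := hrange.trace
    rwa [trace_toLin'_eq, hd, Nat.cast_inj] at this
  let b := Module.finBasisOfFinrankEq R φ.range hrank.symm
  refine ⟨φ.range.subtype.toMatrix b (Pi.basisFun R n),
    hrange.codRestrict.toMatrix (Pi.basisFun R n) b, ?_, ?_⟩
  · have : φ.range.subtype ∘ₗ hrange.codRestrict = φ := by ext; simp
    rw [← LinearMap.toMatrix_comp, this]
    simp [φ]
  · have : hrange.codRestrict ∘ₗ φ.range.subtype = LinearMap.id := by ext; simp
    rw [← LinearMap.toMatrix_comp, this, LinearMap.toMatrix_id]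

theorem eq_of_forall_localization_maximal {x y : R} (h : ∀ (J : Ideal R) [J.IsMaximal],
    algebraMap R (Localization.AtPrime J) x = algebraMap R (Localization.AtPrime J) y) : x = y :=
  MaximalSpectrum.toPiLocalization_injective R (funext fun J => h J.asIdeal)

variable [Algebra ℚ R] {e : Matrix n n R} (he : IsIdempotentElem e) {d : ℕ} (hd : e.trace = d)

include he hd

theorem exists_minorMatrix_map_localization_eq_vecMulVec (J : Ideal R) [J.IsMaximal] :
    ∃ v w : (Fin d → n) → Localization.AtPrime J,
      (minorMatrix (Fin d) e).map (algebraMap R (Localization.AtPrime J)) = vecMulVec v w ∧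
        (vecMulVec v w).trace = d.factorial := by
  have : CharZero (Localization.AtPrime J) := algebraRat.charZero _
  let g := algebraMap R (Localization.AtPrime J)
  have hge : IsIdempotentElem (e.map g) := by
    rw [IsIdempotentElem, ← Matrix.map_mul, he.eq]
  have hgd : (e.map g).trace = d := by rw [← AddMonoidHom.map_trace, hd, map_natCast]
  obtain ⟨U, V, hUV, hVU⟩ := exists_mul_eq_and_mul_eq_one_of_isLocalRing hge hgd
  have h_minors := minorMatrix_map (κ := Fin d) g e
  rw [← hUV, minorMatrix_mul] at h_minors
  refine ⟨_, _, h_minors, ?_⟩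
  rw [← minorMatrix_mul, trace_minorMatrix_mul, hVU, det_one, mul_one, Fintype.card_fin]

theorem trace_minorMatrix : (minorMatrix (Fin d) e).trace = d.factorial := by
  refine eq_of_forall_localization_maximal fun J _ => ?_
  obtain ⟨v, w, hvw, htrace⟩ := exists_minorMatrix_map_localization_eq_vecMulVec he hd J
  rw [AddMonoidHom.map_trace, hvw, htrace, map_natCast]

theorem minorMatrix_mul_mul_minorMatrix (X : Matrix (Fin d → n) (Fin d → n) R) :
    minorMatrix (Fin d) e * X * minorMatrix (Fin d) e =
      (minorMatrix (Fin d) e * X).trace • minorMatrix (Fin d) e := by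
  ext f h
  refine eq_of_forall_localization_maximal fun J _ => ?_
  obtain ⟨v, w, hvw, -⟩ := exists_minorMatrix_map_localization_eq_vecMulVec he hd J
  let g := algebraMap R (Localization.AtPrime J)
  have h_map : (minorMatrix (Fin d) e * X * minorMatrix (Fin d) e).map g =
      ((minorMatrix (Fin d) e * X).trace • minorMatrix (Fin d) e).map g := by
    rw [Matrix.map_smul' _ _ _ (map_mul g), AddMonoidHom.map_trace]
    simp only [Matrix.map_mul]
    rw [hvw, vecMulVec_mul_mul_vecMulVec]
  exact congr_fun₂ h_map f h

end Idempotent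
end Minors

/-! ### Splittings and descent of the trace -/

section Trace

theorem trace_smul_map_eq_trace_smul_map {D Q ι : Type*} [CommRing D] [AddCommGroup Q]
    [Module D Q] [Fintype ι] (q : Matrix ι ι D →ₗ[D] Q)
    (hq : ∀ X Y, q (X * Y) = q (Y * X)) (X Y : Matrix ι ι D) :
    Y.trace • q X = X.trace • q Y := by
  classical
  have q_single (k l i : ι) (a : D) :
      q (single k l a) = (single k l a).trace • q (single i i 1) := by
    obtain rfl | hkl := eq_or_ne k l
    · have h := hq (single k i a) (single i k 1)
      rw [single_mul_single_same, single_mul_single_same, mul_one, one_mul] at h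
      rw [h, trace_single_eq_same, ← map_smul, smul_single, smul_eq_mul, mul_one]
    · have h := hq (single k k 1) (single k l a)
      rw [single_mul_single_same, one_mul, single_mul_single_of_ne _ _ _ _ hkl.symm,
        map_zero] at h
      rw [h, trace_single_eq_of_ne _ _ _ hkl, zero_smul]
  have q_eq (i : ι) : q = (traceLinearMap ι D D).smulRight (q (single i i 1)) :=
    ext_linearMap _ fun k l => LinearMap.ext fun a => q_single k l i a
  obtain h | ⟨⟨i⟩⟩ := isEmpty_or_nonempty ι
  · simp [Subsingleton.elim X 0, Subsingleton.elim Y 0]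
  · rw [q_eq i]
    exact smul_comm _ _ _

theorem map_mul_comm_of_isBaseChange {C B D A Q : Type*} [CommRing C] [Ring B] [Algebra C B]
    [CommRing D] [Algebra C D] [Ring A] [Algebra C A] [Algebra D A] [IsScalarTower C D A]
    [AddCommGroup Q] [Module D Q] {ρ : B →ₐ[C] A} (hρ : IsBaseChange D ρ.toLinearMap)
    {q : A →ₗ[D] Q} (hq : ∀ x y, q (ρ x * ρ y) = q (ρ y * ρ x)) (X Y : A) :
    q (X * Y) = q (Y * X) := by
  induction X using hρ.inductionOn with
  | zero => simp
  | add X₁ X₂ h₁ h₂ => rw [add_mul, mul_add, map_add, map_add, h₁, h₂]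
  | smul s X h => rw [smul_mul_assoc, mul_smul_comm, map_smul, map_smul, h]
  | tmul x =>
    induction Y using hρ.inductionOn with
    | zero => simp
    | add Y₁ Y₂ h₁ h₂ => rw [add_mul, mul_add, map_add, map_add, h₁, h₂]
    | smul s Y h => rw [smul_mul_assoc, mul_smul_comm, map_smul, map_smul, h]
    | tmul y => exact hq x y

end Trace

/-- A splitting of a `C`-algebra `B` over a finite faithfully flat cover: representations of `B` by
matrices over the members `D j` of the cover which identify `D j ⊗ B` with the full matrix algebra.
Unlike for an `EtaleSplitting`, the matrices may be indexed by any finite types, so that splittings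
can be tensored. -/
structure MatrixSplitting (C B : Type u) [CommRing C] [Ring B] [Algebra C B] where
  J : Type
  [finite : Finite J]
  D : J → Type u
  [commRing : ∀ j, CommRing (D j)]
  [algebra : ∀ j, Algebra C (D j)]
  faithfullyFlat : Module.FaithfullyFlat C (∀ j, D j)
  ι : J → Type
  [fintype : ∀ j, Fintype (ι j)]
  [decidableEq : ∀ j, DecidableEq (ι j)]
  rep : ∀ j, B →ₐ[C] Matrix (ι j) (ι j) (D j)
  isBaseChange : ∀ j, IsBaseChange (D j) (rep j).toLinearMap

attribute [instance] MatrixSplitting.finite MatrixSplitting.commRing MatrixSplitting.algebra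
  MatrixSplitting.faithfullyFlat MatrixSplitting.fintype MatrixSplitting.decidableEq

theorem eq_zero_of_forall_one_tmul_eq_zero {C : Type u} [CommRing C] {J : Type*} [Finite J]
    {D : J → Type u} [∀ j, CommRing (D j)] [∀ j, Algebra C (D j)]
    [Module.FaithfullyFlat C (∀ j, D j)] {M : Type u} [AddCommGroup M] [Module C M] {m : M}
    (h : ∀ j, (1 : D j) ⊗ₜ[C] m = 0) : m = 0 := by
  classical
  cases nonempty_fintype J
  rw [← Module.FaithfullyFlat.one_tmul_eq_zero_iff C M (A := ∀ j, D j)]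
  apply (TensorProduct.piLeft C M D).injective
  ext j
  simpa using h j

/-- The splitting underlying an étale one. -/
noncomputable def EtaleSplitting.toMatrixSplitting {C B : Type u} [CommRing C] [Ring B]
    [Algebra C B] (S : EtaleSplitting C B) : MatrixSplitting C B where
  J := Fin S.r
  D := S.D
  faithfullyFlat := S.faithfullyFlat
  ι j := Fin (S.n j)
  rep j := ((S.iso j).toAlgHom.restrictScalars C).comp Algebra.TensorProduct.includeRight
  isBaseChange j := .of_equiv (S.iso j).toLinearEquiv fun _ => rfl

namespace MatrixSplitting

variable {C B : Type u} [CommRing C] [Ring B] [Algebra C B] (S : MatrixSplitting C B)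

theorem algebraMap_injective {s t : C}
    (h : ∀ j, algebraMap C (S.D j) s = algebraMap C (S.D j) t) : s = t :=
  FaithfulSMul.algebraMap_injective C (∀ j, S.D j) (funext h)

theorem ext_rep {x y : B} (h : ∀ j, S.rep j x = S.rep j y) : x = y := by
  refine sub_eq_zero.1 (eq_zero_of_forall_one_tmul_eq_zero (C := C) (D := S.D) fun j => ?_)
  rw [← (S.isBaseChange j).equiv_symm_apply, AlgHom.toLinearMap_apply, map_sub, h, sub_self,
    map_zero]

theorem eq_top_of_commutator_mem {N : Submodule C B} (hN : ∀ x y, x * y - y * x ∈ N) {e : B}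
    (he : e ∈ N) (he_unit : ∀ j, IsUnit (S.rep j e).trace) : N = ⊤ := by
  refine N.eq_top_iff'.2 fun b => ?_
  rw [← Submodule.Quotient.mk_eq_zero]
  refine eq_zero_of_forall_one_tmul_eq_zero (C := C) (D := S.D) fun j => ?_
  let f : B →ₗ[C] S.D j ⊗[C] (B ⧸ N) := TensorProduct.mk C (S.D j) (B ⧸ N) 1 ∘ₗ N.mkQ
  have f_eq_zero : ∀ x ∈ N, f x = 0 := fun x hx => by
    simp [f, (Submodule.Quotient.mk_eq_zero N).2 hx]
  let q := (S.isBaseChange j).lift f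
  have q_rep : ∀ x, q (S.rep j x) = f x := (S.isBaseChange j).lift_eq f
  have q_comm : ∀ X Y, q (X * Y) = q (Y * X) :=
    map_mul_comm_of_isBaseChange (S.isBaseChange j) fun x y => by
      rw [← map_mul, ← map_mul, q_rep, q_rep, ← sub_eq_zero, ← map_sub, f_eq_zero _ (hN x y)]
  have h := trace_smul_map_eq_trace_smul_map q q_comm (S.rep j b) (S.rep j e)
  rwa [q_rep, q_rep, f_eq_zero e he, smul_zero, (he_unit j).smul_eq_zero] at h

theorem exists_algebraMap_eq_trace {e : B} {t : C} (ht : IsUnit t)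
    (he : ∀ j, (S.rep j e).trace = algebraMap C (S.D j) t) :
    ∃ T : B →ₗ[C] C, ∀ j b, algebraMap C (S.D j) (T b) = (S.rep j b).trace := by
  let φ : C →ₗ[C] ∀ j, S.D j := Algebra.linearMap C _
  have hφ : Function.Injective φ := FaithfulSMul.algebraMap_injective C (∀ j, S.D j)
  let τ : B →ₗ[C] ∀ j, S.D j :=
    .pi fun j => traceLinearMap (S.ι j) C (S.D j) ∘ₗ (S.rep j).toLinearMap
  have h_top : φ.range.comap τ = ⊤ := by
    refine S.eq_top_of_commutator_mem (fun x y => ⟨0, ?_⟩) (e := e) ⟨t, ?_⟩ fun j => ?_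
    · ext j
      simp [τ, trace_mul_comm (S.rep j x)]
    · exact funext fun j => (he j).symm
    · exact he j ▸ ht.map _
  have h_mem (b : B) : τ b ∈ φ.range := h_top.ge (Submodule.mem_top (x := b))
  refine ⟨(LinearEquiv.ofInjective φ hφ).symm ∘ₗ τ.codRestrict φ.range h_mem, fun j b => ?_⟩
  exact congr_fun (congr_arg Subtype.val
    ((LinearEquiv.ofInjective φ hφ).apply_symm_apply ⟨τ b, h_mem b⟩)) j

end MatrixSplitting

/-! ### The Goldman element -/

section Goldman

theorem sum_apply_mul_apply_of_sum_mul_mul_eq {D ι κ : Type*} [CommRing D] [Fintype ι]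
    [DecidableEq ι] [Fintype κ] {U V : κ → Matrix ι ι D}
    (h : ∀ X, ∑ l, U l * X * V l = X.trace • 1) (i j : ι × ι) :
    ∑ l, U l i.1 j.1 * V l i.2 j.2 = (1 : Matrix (ι × ι) (ι × ι) D) i.swap j := by
  obtain ⟨i, i'⟩ := i
  obtain ⟨j, j'⟩ := j
  have entry (l : κ) : (U l * single j i' 1 * V l : Matrix ι ι D) i j' = U l i j * V l i' j' := by
    simp [mul_apply, single_apply, ite_and]
  have h_entry := congr_fun₂ (h (single j i' 1)) i j'
  rw [Matrix.sum_apply, Finset.sum_congr rfl fun l _ => entry l] at h_entry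
  rw [h_entry, Matrix.smul_apply, smul_eq_mul]
  obtain rfl | hij := eq_or_ne i' j
  · simp [one_apply, trace_single_eq_same]
  · simp [one_apply, trace_single_eq_of_ne _ _ _ hij.symm, hij]

theorem exists_sum_mul_mul_eq {C E : Type*} [CommRing C] [Ring E] [Algebra C E] [IsAzumaya C E]
    (T : E →ₗ[C] C) :
    ∃ (k : ℕ) (a b : Fin k → E), ∀ x, ∑ l, a l * x * b l = algebraMap C E (T x) := by
  obtain ⟨z, hz⟩ := (IsAzumaya.bij (R := C) (A := E)).2 (Algebra.linearMap C E ∘ₗ T)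
  obtain ⟨k, a, b, rfl⟩ := TensorProduct.exists_sum_tmul_eq z
  exact ⟨k, a, fun l => (b l).unop, fun x => by simpa using LinearMap.congr_fun hz x⟩

theorem sum_mul_mul_eq_trace_smul_one {C B D ι κ : Type*} [CommRing C] [Ring B] [Algebra C B]
    [CommRing D] [Algebra C D] [Fintype ι] [DecidableEq ι] [Fintype κ]
    {ρ : B →ₐ[C] Matrix ι ι D} (hρ : IsBaseChange D ρ.toLinearMap)
    {T : B →ₗ[C] C} (hT : ∀ x, algebraMap C D (T x) = (ρ x).trace) {a b : κ → B}
    (hab : ∀ x, ∑ l, a l * x * b l = algebraMap C B (T x)) (X : Matrix ι ι D) :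
    ∑ l, ρ (a l) * X * ρ (b l) = X.trace • 1 := by
  have h : ∑ l, LinearMap.mulLeftRight D (ρ (a l), ρ (b l)) =
      (traceLinearMap ι D D).smulRight (1 : Matrix ι ι D) :=
    hρ.algHom_ext _ _ fun x => by
      simp only [LinearMap.sum_apply, LinearMap.mulLeftRight_apply, AlgHom.toLinearMap_apply,
        LinearMap.smulRight_apply, traceLinearMap_apply, ← map_mul, ← map_sum, hab, ← hT]
      rw [AlgHom.commutes, Algebra.algebraMap_eq_smul_one, algebraMap_smul]
  simpa using LinearMap.congr_fun h X

variable {C A B D ι κ : Type*} [CommRing C] [Ring A] [Algebra C A] [Ring B] [Algebra C B]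
  [CommRing D] [Algebra C D] [Fintype ι] [DecidableEq ι] [Fintype κ] [DecidableEq κ]

/-- The tensor product of two matrix representations. -/
noncomputable def kroneckerRep (ρ : A →ₐ[C] Matrix ι ι D) (σ : B →ₐ[C] Matrix κ κ D) :
    A ⊗[C] B →ₐ[C] Matrix (ι × κ) (ι × κ) D :=
  (((kroneckerAlgEquiv ι κ D).toAlgHom.restrictScalars C).comp
    (Algebra.TensorProduct.mapOfCompatibleSMul D C C _ _)).comp (Algebra.TensorProduct.map ρ σ)

theorem kroneckerRep_tmul (ρ : A →ₐ[C] Matrix ι ι D) (σ : B →ₐ[C] Matrix κ κ D) (a : A) (b : B)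
    (i j : ι × κ) : kroneckerRep ρ σ (a ⊗ₜ b) i j = ρ a i.1 j.1 * σ b i.2 j.2 :=
  rfl

theorem isBaseChange_kroneckerRep {ρ : A →ₐ[C] Matrix ι ι D} {σ : B →ₐ[C] Matrix κ κ D}
    (hρ : IsBaseChange D ρ.toLinearMap) (hσ : IsBaseChange D σ.toLinearMap) :
    IsBaseChange D (kroneckerRep ρ σ).toLinearMap := by
  refine .of_equiv ((TensorProduct.AlgebraTensorModule.distribBaseChange C D A B).trans
    ((TensorProduct.congr hρ.equiv hσ.equiv).trans (kroneckerLinearEquiv ι ι κ κ D)))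
    fun z => ?_
  induction z with
  | zero => simp
  | add x y hx hy => rw [TensorProduct.tmul_add, map_add, hx, hy, map_add]
  | tmul a b =>
    ext i j
    simp [TensorProduct.AlgebraTensorModule.distribBaseChange, kroneckerRep_tmul,
      IsBaseChange.equiv_tmul]

end Goldman

theorem MatrixSplitting.exists_kroneckerRep_eq_swap {C B : Type u} [CommRing C] [Ring B]
    [Algebra C B] [IsAzumaya C B] (S : MatrixSplitting C B) {T : B →ₗ[C] C}
    (hT : ∀ j b, algebraMap C (S.D j) (T b) = (S.rep j b).trace) :
    ∃ g : B ⊗[C] B, ∀ j, kroneckerRep (S.rep j) (S.rep j) g =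
      (1 : Matrix (S.ι j × S.ι j) (S.ι j × S.ι j) (S.D j)).submatrix Prod.swap id := by
  obtain ⟨k, a, b, hab⟩ := exists_sum_mul_mul_eq T
  refine ⟨∑ l, a l ⊗ₜ b l, fun j => ?_⟩
  ext x y
  rw [map_sum, Matrix.sum_apply]
  exact sum_apply_mul_apply_of_sum_mul_mul_eq
    (sum_mul_mul_eq_trace_smul_one (S.isBaseChange j) (hT j) hab) x y

/-! ### Tensor powers -/

open PiTensorProduct

section TensorPower

variable {C B : Type u} [CommRing C] [Ring B] [Algebra C B]

/-- The linear equivalence underlying `tensorPowerSuccEquiv`. -/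
noncomputable def tensorPowerSuccLinearEquiv (C B : Type u) [CommRing C] [Ring B] [Algebra C B]
    (m : ℕ) : (⨂[C]^(m + 1)) B ≃ₗ[C] (⨂[C]^m) B ⊗[C] B :=
  reindex C (fun _ => B) finSumFinEquiv.symm ≪≫ₗ (tmulEquiv C B).symm ≪≫ₗ
    TensorProduct.congr (.refl C _) (subsingletonEquiv (s := fun _ => B) (0 : Fin 1))

theorem tensorPowerSuccLinearEquiv_tprod (m : ℕ) (b : Fin (m + 1) → B) :
    tensorPowerSuccLinearEquiv C B m (tprod C b) = tprod C (Fin.init b) ⊗ₜ b (Fin.last m) := by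
  simp only [tensorPowerSuccLinearEquiv, LinearEquiv.trans_apply, reindex_tprod, Equiv.symm_symm,
    tmulEquiv_symm_apply, finSumFinEquiv_apply_left, finSumFinEquiv_apply_right,
    TensorProduct.congr_tmul, LinearEquiv.refl_apply, subsingletonEquiv_apply_tprod]
  rfl

/-- The algebra equivalence `B^{⊗(m+1)} ≃ B^{⊗m} ⊗ B` splitting off the last tensor factor. -/
noncomputable def tensorPowerSuccEquiv (C B : Type u) [CommRing C] [Ring B] [Algebra C B] (m : ℕ) :
    (⨂[C]^(m + 1)) B ≃ₐ[C] (⨂[C]^m) B ⊗[C] B :=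
  .ofLinearEquiv (tensorPowerSuccLinearEquiv C B m) (tensorPowerSuccLinearEquiv_tprod m 1) <|
    (LinearMap.map_mul_iff (tensorPowerSuccLinearEquiv C B m).toLinearMap).2 <| by
      ext b c
      simp only [LinearMap.compMultilinearMap_apply, LinearMap.compr₂_apply,
        LinearMap.mul_apply_apply, tprod_mul_tprod, LinearEquiv.coe_coe,
        tensorPowerSuccLinearEquiv_tprod, LinearMap.compl₂_apply, LinearMap.coe_comp,
        Function.comp_apply, Algebra.TensorProduct.tmul_mul_tmul]
      rfl

theorem tensorPowerSuccEquiv_tprod (m : ℕ) (b : Fin (m + 1) → B) :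
    tensorPowerSuccEquiv C B m (tprod C b) = tprod C (Fin.init b) ⊗ₜ b (Fin.last m) :=
  tensorPowerSuccLinearEquiv_tprod m b

/-- The algebra equivalence between the empty tensor power and the ground ring. -/
noncomputable def tensorPowerZeroEquiv (C B : Type u) [CommRing C] [Ring B] [Algebra C B] :
    (⨂[C]^0) B ≃ₐ[C] C :=
  let f : (⨂[C]^0) B ≃ₗ[C] C := isEmptyEquiv (Fin 0)
  .ofLinearEquiv f (isEmptyEquiv_apply_tprod (Fin 0) 1) <|
    (LinearMap.map_mul_iff f.toLinearMap).2 <| by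
      ext b c
      simp [f]

instance isAzumaya_tensorPower [IsAzumaya C B] (m : ℕ) : IsAzumaya C ((⨂[C]^m) B) := by
  induction m with
  | zero => exact .of_AlgEquiv C C _ (tensorPowerZeroEquiv C B).symm
  | succ m ih =>
    have := isAzumaya_tensor (C := C) ((⨂[C]^m) B) B
    exact .of_AlgEquiv C _ _ (tensorPowerSuccEquiv C B m).symm

theorem brauerClass_tensorPower [IsAzumaya C B] (m : ℕ) :
    brauerClass C ((⨂[C]^m) B) = brauerClass C B ^ m := by
  induction m with
  | zero => exact Quotient.sound (s := brauerSetoid C) (.of_algEquiv (tensorPowerZeroEquiv C B))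
  | succ m ih =>
    rw [pow_succ, ← ih]
    exact Quotient.sound (s := brauerSetoid C) (.of_algEquiv (tensorPowerSuccEquiv C B m))

end TensorPower

theorem one_pi_apply {D ι κ : Type*} [CommSemiring D] [DecidableEq ι] [Fintype κ]
    [DecidableEq (κ → ι)] (f h : κ → ι) :
    (1 : Matrix (κ → ι) (κ → ι) D) f h = ∏ k, (1 : Matrix ι ι D) (f k) (h k) := by
  simp [one_apply, funext_iff, Finset.prod_ite_zero]

section PiRep

variable {C B D ι κ : Type*} [CommRing C] [Ring B] [Algebra C B] [CommRing D] [Algebra C D]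
  [Fintype ι] [DecidableEq ι] [Fintype κ] [DecidableEq κ]

variable (κ) in
/-- The tensor power of a matrix representation, indexed by a finite type `κ`. -/
noncomputable def piRep (ρ : B →ₐ[C] Matrix ι ι D) :
    (⨂[C] _ : κ, B) →ₐ[C] Matrix (κ → ι) (κ → ι) D :=
  liftAlgHom
    ((ofLinearEquiv C).toLinearMap.compMultilinearMap <| .pi fun f => .pi fun h =>
      (MultilinearMap.mkPiAlgebra C κ D).compLinearMap fun k =>
        entryLinearMap C D (f k) (h k) ∘ₗ ρ.toLinearMap)
    (by
      ext f h
      change ∏ k, ρ 1 (f k) (h k) = _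
      rw [map_one, one_pi_apply])
    fun b c => by
      ext f h
      change ∏ k, ρ (b k * c k) (f k) (h k) =
        ∑ i : κ → ι, (∏ k, ρ (b k) (f k) (i k)) * ∏ k, ρ (c k) (i k) (h k)
      simp only [map_mul, mul_apply, Fintype.prod_sum, Finset.prod_mul_distrib]

theorem piRep_tprod (ρ : B →ₐ[C] Matrix ι ι D) (b : κ → B) (f h : κ → ι) :
    piRep κ ρ (tprod C b) f h = ∏ k, ρ (b k) (f k) (h k) := by
  simp [piRep]

end PiRep

section PiRepFin

variable {C B : Type u} {D ι : Type*} [CommRing C] [Ring B] [Algebra C B] [CommRing D]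
  [Algebra C D] [Fintype ι] [DecidableEq ι]

theorem piRep_fin_succ (ρ : B →ₐ[C] Matrix ι ι D) (m : ℕ) (z : (⨂[C]^(m + 1)) B)
    (f h : Fin (m + 1) → ι) :
    piRep (Fin (m + 1)) ρ z f h = kroneckerRep (piRep (Fin m) ρ) ρ (tensorPowerSuccEquiv C B m z)
      (Fin.init f, f (Fin.last m)) (Fin.init h, h (Fin.last m)) := by
  induction z using PiTensorProduct.induction_on with
  | smul_tprod r b =>
    rw [map_smul, map_smul, map_smul, Matrix.smul_apply, Matrix.smul_apply]
    simp [tensorPowerSuccEquiv_tprod, kroneckerRep_tmul, piRep_tprod, Fin.prod_univ_castSucc,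
      Fin.init]
  | add x y hx hy => simp only [map_add, Matrix.add_apply, hx, hy]

theorem isBaseChange_piRep {ρ : B →ₐ[C] Matrix ι ι D} (hρ : IsBaseChange D ρ.toLinearMap) (m : ℕ) :
    IsBaseChange D (piRep (Fin m) ρ).toLinearMap := by
  induction m with
  | zero =>
    refine .of_equiv ((tensorPowerZeroEquiv C B).toLinearEquiv.baseChange C D _ _ ≪≫ₗ
      TensorProduct.AlgebraTensorModule.rid C D D ≪≫ₗ
      (uniqueLinearEquiv (m := Fin 0 → ι) (n := Fin 0 → ι) (A := D) (R := D)).symm) fun z => ?_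
    obtain ⟨c, rfl⟩ : ∃ c, algebraMap C _ c = z :=
      ⟨tensorPowerZeroEquiv C B z, (tensorPowerZeroEquiv C B).injective (by simp)⟩
    ext f h
    simp [algebraMap_eq_diagonal, Subsingleton.elim f h, Algebra.smul_def]
  | succ m ih =>
    refine .of_equiv ((tensorPowerSuccEquiv C B m).toLinearEquiv.baseChange C D _ _ ≪≫ₗ
      (isBaseChange_kroneckerRep ih hρ).equiv ≪≫ₗ
      reindexLinearEquiv D D ((Equiv.prodComm _ _).trans (Fin.snocEquiv fun _ => ι))
        ((Equiv.prodComm _ _).trans (Fin.snocEquiv fun _ => ι))) fun z => ?_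
    ext f h
    simp [piRep_fin_succ, IsBaseChange.equiv_tmul]

end PiRepFin

/-- The `m`-th tensor power of a splitting of `B`, a splitting of `B^{⊗m}`. -/
noncomputable def MatrixSplitting.tensorPower {C B : Type u} [CommRing C] [Ring B] [Algebra C B]
    (S : MatrixSplitting C B) (m : ℕ) : MatrixSplitting C ((⨂[C]^m) B) where
  J := S.J
  D := S.D
  faithfullyFlat := S.faithfullyFlat
  ι j := Fin m → S.ι j
  rep j := piRep (Fin m) (S.rep j)
  isBaseChange j := isBaseChange_piRep (S.isBaseChange j) m

section Permutation

variable {C B κ : Type*} [CommRing C] [Ring B] [Algebra C B] [DecidableEq κ]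

/-- The embedding of `B ⊗ B` into a tensor power of `B` as the factors `x` and `y`. -/
noncomputable def pairAlgHom {x y : κ} (hxy : x ≠ y) : B ⊗[C] B →ₐ[C] ⨂[C] _ : κ, B :=
  Algebra.TensorProduct.lift (singleAlgHom (A := fun _ => B) x) (singleAlgHom (A := fun _ => B) y)
    fun a b => .tprod (Pi.mulSingle_commute (f := fun _ => B) hxy a b)

theorem pairAlgHom_tmul {x y : κ} (hxy : x ≠ y) (a b : B) :
    pairAlgHom hxy (a ⊗ₜ[C] b) =
      PiTensorProduct.tprod C (Pi.mulSingle x a * Pi.mulSingle y b : κ → B) :=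
  tprod_mul_tprod _ _

variable {D ι : Type*} [CommRing D] [Algebra C D] [Fintype ι] [DecidableEq ι] [Fintype κ]
  (ρ : B →ₐ[C] Matrix ι ι D)

theorem piRep_pairAlgHom {x y : κ} (hxy : x ≠ y) (z : B ⊗[C] B) (f h : κ → ι) :
    piRep κ ρ (pairAlgHom hxy z) f h = kroneckerRep ρ ρ z (f x, f y) (h x, h y) *
      ∏ k ∈ {x, y}ᶜ, (1 : Matrix ι ι D) (f k) (h k) := by
  induction z with
  | zero => simp
  | add z w hz hw => simp only [map_add, Matrix.add_apply, hz, hw, add_mul]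
  | tmul a b =>
    rw [pairAlgHom_tmul, piRep_tprod, ← Finset.prod_mul_prod_compl {x, y}, Finset.prod_pair hxy,
      kroneckerRep_tmul]
    congr 1
    · simp [hxy, hxy.symm]
    · refine Finset.prod_congr rfl fun k hk => ?_
      obtain ⟨hkx, hky⟩ : k ≠ x ∧ k ≠ y := by simpa using hk
      simp [hkx, hky]

theorem piRep_pairAlgHom_eq_swap {g : B ⊗[C] B}
    (hg : kroneckerRep ρ ρ g = (1 : Matrix (ι × ι) (ι × ι) D).submatrix Prod.swap id)
    {x y : κ} (hxy : x ≠ y) :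
    piRep κ ρ (pairAlgHom hxy g) =
      (1 : Matrix (κ → ι) (κ → ι) D).submatrix (· ∘ Equiv.swap x y) id := by
  ext f h
  rw [piRep_pairAlgHom, hg, submatrix_apply, submatrix_apply, one_pi_apply,
    ← Finset.prod_mul_prod_compl {x, y}, Finset.prod_pair hxy]
  congr 1
  · simp [one_apply, ← ite_and, and_comm]
  · refine Finset.prod_congr rfl fun k hk => ?_
    obtain ⟨hkx, hky⟩ : k ≠ x ∧ k ≠ y := by simpa using hk
    rw [id, Function.comp_apply, Equiv.swap_apply_of_ne_of_ne hkx hky]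

end Permutation

namespace MatrixSplitting

variable {C B : Type u} [CommRing C] [Ring B] [Algebra C B] [IsAzumaya C B]
  {S : MatrixSplitting C B} {T : B →ₗ[C] C}
  (hT : ∀ j b, algebraMap C (S.D j) (T b) = (S.rep j b).trace)
  {κ : Type*} [Fintype κ] [DecidableEq κ]

include hT

theorem exists_piRep_eq_perm (σ : Equiv.Perm κ) :
    ∃ t : ⨂[C] _ : κ, B, ∀ j, piRep κ (S.rep j) t =
      (1 : Matrix (κ → S.ι j) (κ → S.ι j) (S.D j)).submatrix (· ∘ σ) id := by
  obtain ⟨g, hg⟩ := S.exists_kroneckerRep_eq_swap hT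
  induction σ using Equiv.Perm.swap_induction_on with
  | one => exact ⟨1, fun j => map_one _⟩
  | swap_mul σ x y hxy ih =>
    obtain ⟨t, ht⟩ := ih
    refine ⟨pairAlgHom hxy g * t, fun j => ?_⟩
    rw [map_mul, ht, piRep_pairAlgHom_eq_swap _ (hg j)]
    exact one_submatrix_mul _ (Equiv.refl _) _

theorem exists_piRep_eq_minorMatrix (e : B) :
    ∃ a : ⨂[C] _ : κ, B, ∀ j, piRep κ (S.rep j) a = minorMatrix κ (S.rep j e) := by
  choose t ht using exists_piRep_eq_perm hT (κ := κ)
  refine ⟨∑ σ, Equiv.Perm.sign σ • (t σ * ⨂ₜ[C] _, e), fun j => ?_⟩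
  have rep_perm_mul (σ : Equiv.Perm κ) : piRep κ (S.rep j) (t σ * ⨂ₜ[C] _, e) =
      (piRep κ (S.rep j) (⨂ₜ[C] _, e)).submatrix (· ∘ σ) id := by
    rw [map_mul, ht]
    exact one_submatrix_mul _ (Equiv.refl _) _
  ext f h
  simp only [map_sum, map_zsmul, Units.smul_def, Matrix.sum_apply, Matrix.smul_apply, rep_perm_mul,
    submatrix_apply, piRep_tprod, minorMatrix_apply, det_apply]
  rfl

end MatrixSplitting

/-! ### Rank one idempotents -/

section RankOne

/-- The left ideal `E ε`. If `ε` is a full idempotent of rank one, left multiplication identifies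
`E` with its endomorphism algebra. -/
abbrev leftIdeal {E : Type*} [Ring E] (ε : E) : Submodule E E :=
  (LinearMap.toSpanSingleton E E ε).range

variable {C E : Type*} [CommRing C] [Ring E] [Algebra C E] {ε : E}

theorem mul_eq_of_mem_leftIdeal (hε : IsIdempotentElem ε) {z : E} (hz : z ∈ leftIdeal ε) :
    z * ε = z := by
  obtain ⟨y, rfl⟩ := hz
  rw [LinearMap.toSpanSingleton_apply, smul_eq_mul, mul_assoc, hε.eq]

theorem finite_leftIdeal [Module.Finite C E] (ε : E) : Module.Finite C (leftIdeal ε) :=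
  .of_surjective ((LinearMap.toSpanSingleton E E ε).rangeRestrict.restrictScalars C)
    (LinearMap.surjective_rangeRestrict _)

theorem projective_leftIdeal [Module.Projective C E] (hε : IsIdempotentElem ε) :
    Module.Projective C (leftIdeal ε) :=
  .of_split ((leftIdeal ε).subtype.restrictScalars C)
    ((LinearMap.toSpanSingleton E E ε).rangeRestrict.restrictScalars C) <|
    LinearMap.ext fun z => Subtype.ext (mul_eq_of_mem_leftIdeal hε z.2)

variable {κ : Type*} [Fintype κ] {a b : κ → E} (hab : ∑ l, a l * ε * b l = 1)

include hab

theorem injective_lsmul_leftIdeal :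
    Function.Injective (Algebra.lsmul C C (leftIdeal ε) : E →ₐ[C] _) := by
  rw [injective_iff_map_eq_zero]
  intro x hx
  have mul_eq_zero (l : κ) : x * (a l * ε) = 0 :=
    congrArg Subtype.val (LinearMap.congr_fun hx ⟨a l * ε, a l, rfl⟩)
  rw [← mul_one x, ← hab, Finset.mul_sum]
  refine Finset.sum_eq_zero fun l _ => ?_
  rw [← mul_assoc, mul_eq_zero, zero_mul]

theorem faithfulSMul_leftIdeal [FaithfulSMul C E] : FaithfulSMul C (leftIdeal ε) where
  eq_of_smul_eq_smul {c c'} h := by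
    refine FaithfulSMul.algebraMap_injective C E <| injective_lsmul_leftIdeal (C := C) hab ?_
    ext z
    simpa using congrArg Subtype.val (h z)

theorem surjective_lsmul_leftIdeal (hε : IsIdempotentElem ε)
    (hC : ∀ x, ∃ c : C, ε * x * ε = c • ε) :
    Function.Surjective (Algebra.lsmul C C (leftIdeal ε) : E →ₐ[C] _) := by
  choose c hc using hC
  have mul_mul_eq (x y : leftIdeal ε) (z : E) : (x : E) * z * y = c (z * y) • (x : E) := by
    have hx := mul_eq_of_mem_leftIdeal hε x.2
    have hy := mul_eq_of_mem_leftIdeal hε y.2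
    calc (x : E) * z * y = x * ε * z * (y * ε) := by rw [hx, hy]
      _ = x * (ε * (z * y) * ε) := by simp only [mul_assoc]
      _ = c (z * y) • (x : E) := by rw [hc, mul_smul_comm, hx]
  let p (l : κ) : leftIdeal ε := ⟨a l * ε, a l, rfl⟩
  refine fun f => ⟨∑ l, (f (p l) : E) * b l, LinearMap.ext fun z => ?_⟩
  have z_eq : z = ∑ l, c (b l * z) • p l := by
    refine Subtype.ext ?_
    simp only [AddSubmonoidClass.coe_finsetSum, Submodule.coe_smul_of_tower, ← mul_mul_eq]
    rw [← Finset.sum_mul, hab, one_mul]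
  conv_rhs => rw [z_eq, map_sum]
  refine Subtype.ext ?_
  simp only [map_smul, AddSubmonoidClass.coe_finsetSum, Submodule.coe_smul_of_tower, ← mul_mul_eq]
  exact Finset.sum_mul ..

end RankOne

theorem brauerEquivalent_of_bijective_lsmul {C E P : Type u} [CommRing C] [Ring E] [Algebra C E]
    [AddCommGroup P] [Module C P] [Module.Finite C P] [Module.Projective C P] [FaithfulSMul C P]
    [Module E P] [IsScalarTower C E P]
    (h : Function.Bijective (Algebra.lsmul C C P : E →ₐ[C] Module.End C P)) :
    BrauerEquivalent C E C :=
  ⟨C, P, inferInstance, inferInstance, inferInstance, inferInstance,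
    ⟨inferInstance, inferInstance, inferInstance⟩, ⟨inferInstance, inferInstance, inferInstance⟩,
    ⟨(Algebra.TensorProduct.congr AlgEquiv.refl
        ((AlgEquiv.moduleEndSelf C).symm.trans (AlgEquiv.toOpposite C C).symm)).trans
      ((Algebra.TensorProduct.rid C C _).trans ((AlgEquiv.ofBijective _ h).trans
        (Algebra.TensorProduct.lid C _).symm))⟩⟩

theorem brauerEquivalent_of_rankOne_of_full {C E : Type u} [CommRing C] [Ring E] [Algebra C E]
    [Module.Finite C E] [Module.Projective C E] [FaithfulSMul C E] {ε : E}
    (hε : IsIdempotentElem ε) (hC : ∀ x, ∃ c : C, ε * x * ε = c • ε) {κ : Type*} [Fintype κ]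
    {a b : κ → E} (hab : ∑ l, a l * ε * b l = 1) : BrauerEquivalent C E C :=
  have := finite_leftIdeal (C := C) ε
  have := projective_leftIdeal (C := C) hε
  have := faithfulSMul_leftIdeal (C := C) hab
  brauerEquivalent_of_bijective_lsmul (P := leftIdeal ε)
    ⟨injective_lsmul_leftIdeal hab, surjective_lsmul_leftIdeal hab hε hC⟩

theorem MatrixSplitting.brauerEquivalent_of_rankOne {C E : Type u} [CommRing C] [Ring E]
    [Algebra C E] [IsAzumaya C E] (S : MatrixSplitting C E) {a : E} {t : C} (ht : IsUnit t)
    (h_trace : ∀ j, (S.rep j a).trace = algebraMap C (S.D j) t)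
    (h_mul : ∀ j X, S.rep j a * X * S.rep j a = (S.rep j a * X).trace • S.rep j a) :
    BrauerEquivalent C E C := by
  obtain ⟨T, hT⟩ := S.exists_algebraMap_eq_trace ht h_trace
  obtain ⟨k, u, v, huv⟩ := exists_sum_mul_mul_eq T
  obtain ⟨w, rfl⟩ := ht
  let ε : E := (↑w⁻¹ : C) • a
  have T_a : T a = w := S.algebraMap_injective fun j => by rw [hT, h_trace]
  have T_ε : T ε = 1 := by rw [map_smul, T_a, smul_eq_mul, Units.inv_mul]
  have a_mul_mul (x : E) : a * x * a = T (a * x) • a := S.ext_rep fun j => by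
    rw [map_mul, map_mul, h_mul, ← map_mul, ← hT, map_smul, algebraMap_smul]
  have ε_mul_mul (x : E) : ε * x * ε = T (ε * x) • ε := by
    simp only [ε, smul_mul_assoc, mul_smul_comm, a_mul_mul, map_smul, smul_eq_mul, smul_smul]
    ring_nf
  have hε : IsIdempotentElem ε := by
    rw [IsIdempotentElem]
    simpa only [mul_one, T_ε, one_smul] using ε_mul_mul 1
  refine brauerEquivalent_of_rankOne_of_full hε (fun x => ⟨_, ε_mul_mul x⟩) (a := u) (b := v) ?_
  rw [huv, T_ε, map_one]

theorem brauerClass_pow_eq_one {C B : Type u} [CommRing C] [Algebra ℚ C] [Ring B] [Algebra C B]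
    [IsAzumaya C B] {e : B} (he : IsIdempotentElem e) {d : ℕ} (h_trace : IsReducedTrace e (d : C)) :
    brauerClass C B ^ d = 1 := by
  obtain rfl | hd := eq_or_ne d 0
  · exact pow_zero _
  obtain ⟨S₀, hS₀⟩ := h_trace
  let S := S₀.toMatrixSplitting
  let _ (j) : Algebra ℚ (S.D j) := .compHom (S.D j) (algebraMap ℚ C)
  have hd_unit : IsUnit (d : C) := by
    simpa using (IsUnit.mk0 (d : ℚ) (Nat.cast_ne_zero.2 hd)).map (algebraMap ℚ C)
  obtain ⟨T, hT⟩ := S.exists_algebraMap_eq_trace hd_unit hS₀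
  obtain ⟨a, ha⟩ := S.exists_piRep_eq_minorMatrix hT (κ := Fin d) e
  have rep_idem (j) : IsIdempotentElem (S.rep j e) := he.map (S.rep j)
  have rep_trace (j) : (S.rep j e).trace = d :=
    (hS₀ j).trans (map_natCast (algebraMap C (S.D j)) d)
  have trace_a (j) : (piRep (Fin d) (S.rep j) a).trace = algebraMap C (S.D j) d.factorial := by
    rw [ha, trace_minorMatrix (rep_idem j) (rep_trace j), map_natCast]
  have a_mul_mul (j) (X) : piRep (Fin d) (S.rep j) a * X * piRep (Fin d) (S.rep j) a =
      (piRep (Fin d) (S.rep j) a * X).trace • piRep (Fin d) (S.rep j) a := by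
    rw [ha, minorMatrix_mul_mul_minorMatrix (rep_idem j) (rep_trace j)]
  rw [← brauerClass_tensorPower]
  exact Quotient.sound (s := brauerSetoid C) <| (S.tensorPower d).brauerEquivalent_of_rankOne
    (.natCast_factorial_of_algebra ℚ d) trace_a a_mul_mul

end Azumaya

theorem mainTheorem5_general {C B : Type u} [CommRing C] [Algebra ℚ C] [Ring B] [Algebra C B]
    [IsAzumaya C B] {ι : Type*} (s : Finset ι) (d : ι → ℕ) (e : ι → B)
    (he : ∀ i ∈ s, IsIdempotentElem (e i))
    (h_trace : ∀ i ∈ s, Azumaya.IsReducedTrace (e i) (d i : C)) :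
    Azumaya.period C B ∣ s.gcd d ∧ (s.gcd d = 1 → Azumaya.brauerClass C B = 1) := by
  have h_dvd : Azumaya.period C B ∣ s.gcd d := Finset.dvd_gcd fun i hi =>
    orderOf_dvd_of_pow_eq_one (Azumaya.brauerClass_pow_eq_one (he i hi) (h_trace i hi))
  exact ⟨h_dvd, fun h_gcd => orderOf_eq_one_iff.1 (Nat.dvd_one.1 (h_gcd ▸ h_dvd))⟩

theorem mainTheorem5 {C : Type u} [CommRing C] [Algebra ℂ C]
    {B : Type u} [Ring B] [Algebra C B] [IsAzumaya C B]
    {k : ℕ} (d : Fin k → ℕ) (e : Fin k → B) (he : Azumaya.HasDimensionVector C d e) :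
    Azumaya.period C B ∣ Finset.univ.gcd d ∧
      (Finset.univ.gcd d = 1 → Azumaya.brauerClass C B = 1) := by
  let _ : Algebra ℚ C := .compHom C (algebraMap ℚ ℂ)
  exact mainTheorem5_general _ d e (fun i _ => he.idempotents.idem i) fun i _ => he.trace i
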